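/- Let $(\Sigma,D)$ be a dependence alphabet, i.e. $\Sigma$ is a finite set of letters and $D\subseteq\Sigma\times\Sigma$ is reflexive and symmetric. Two letters are independent if they are distinct and $(a,b)\notin D$. Let $\mathbb M=\Sigma^*/{\sim}$ be the trace monoid, where $\sim$ is the least monoid congruence with $ab\sim ba$ for all independent $a,b$, and let $[w]$ denote the trace induced by the word $w$. A trace language $\mathcal K\subseteq\mathbb M$ is recognizable if the word language $\{w\in\Sigma^*\mid [w]\in\mathcal K\}$ is regular. Let $\mathcal F$ be the set of all sets $A\subseteq\Sigma$ of pairwise independent letters (including $\emptyset$); for $A=\{a_1,\dots,a_m\}\in\mathcal F$ with $a_1,\dots,a_m$ distinct, let $[A]=[a_1\cdots a_m]$, and extend this to a homomorphism $[\cdot]\colon\mathcal F^*\to\mathbb M$. A word $A_1A_2\cdots A_n\in\mathcal F^*$ is in extended Foata normal form if for all $1\le i<n$ and $b\in A_{i+1}$ there is $a\in A_i$ with $(a,b)\in D$. For $\mathcal R\subseteq\mathbb M^2$, let $L_{\mathcal R}\subseteq(\mathcal F^2)^*$ be the set of all words $(A_1,C_1)(A_2,C_2)\cdots(A_n,C_n)$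 such that $A_1\cdots A_n$ and $C_1\cdots C_n$ are in extended Foata normal form and $([A_1\cdots A_n],[C_1\cdots C_n])\in\mathcal R$. The relation $\mathcal R$ is fnf-automatic if $L_{\mathcal R}$ is regular. Lemma. Let $\mathcal R\subseteq\mathbb M^2$ be fnf-automatic and let $\mathcal K,\mathcal L\subseteq\mathbb M$ be recognizable. Then \[ \mathcal R\cdot(\mathcal K\times\mathcal L)=\{(x_1y,x_2z)\mid (x_1,x_2)\in\mathcal R,\ y\in\mathcal K,\ z\in\mathcal L\} \] is effectively fnf-automatic. That is, it is fnf-automatic, and there is an algorithm that, given $(\Sigma,D)$ (with $\Sigma=\{0,\dots,n-1\}$), an NFA for $L_{\mathcal R}$, and NFAs for $\{w\mid[w]\in\mathcal K\}$ and $\{w\mid[w]\in\mathcal L\}$, computes an NFA for $L_{\mathcal R\cdot(\mathcal K\times\mathcal L)}$. -/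

import Mathlib

namespace FoataTrace

universe u

/-- A dependence relation on an alphabet `α`: a reflexive and symmetric relation.  A dependence
alphabet is a finite type `α` together with such a relation. -/
structure Dependence (α : Type u) where
  /-- `D.Dep a b` means `(a, b) ∈ D`. -/
  Dep : α → α → Prop
  refl : ∀ a, Dep a a
  symm : ∀ a b, Dep a b → Dep b a

namespace Dependence

variable {α : Type u} (D : Dependence α)

/-- The independence relation: distinct letters that are not dependent. -/
def Indep (a b : α) : Prop := a ≠ b ∧ ¬ D.Dep a b

/-- The defining relations `ab = ba` of the trace monoid, for independent `a` and `b`. -/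
def commRel (u v : FreeMonoid α) : Prop :=
  ∃ a b, D.Indep a b ∧ u = FreeMonoid.of a * FreeMonoid.of b ∧
    v = FreeMonoid.of b * FreeMonoid.of a

/-- The trace monoid: the quotient of the free monoid by the least congruence with `ab ∼ ba`
for independent letters `a` and `b`. -/
abbrev Trace : Type u := PresentedMonoid D.commRel

/-- The trace `[w]` induced by the word `w`. -/
def traceOfWord (w : List α) : D.Trace := PresentedMonoid.mk D.commRel (FreeMonoid.ofList w)

/-- The language of all words that induce a trace in `K`. -/
def wordLanguage (K : Set D.Trace) : Language α := {w | D.traceOfWord w ∈ K}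

/-- A trace language is recognizable if the set of all words inducing one of its elements is a
regular language. -/
def IsRecognizable (K : Set D.Trace) : Prop := (D.wordLanguage K).IsRegular

/-- The set `𝓕` of independent sets of letters (including the empty set). -/
def IndepSet : Type u := {A : Finset α // (A : Set α).Pairwise D.Indep}

theorem commute_of_indep {a b : α} (h : D.Indep a b) :
    Commute (D.traceOfWord [a]) (D.traceOfWord [b]) :=
  PresentedMonoid.mk_eq_mk_of_rel (rels := D.commRel) ⟨a, b, h, rfl, rfl⟩

/-- The trace `[A]` of an independent set `A`: the product of its letters, in any order. -/
def traceOfSet (A : D.IndepSet) : D.Trace :=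
  A.1.noncommProd (fun a => D.traceOfWord [a])
    (fun _ ha _ hb hab => D.commute_of_indep (A.2 ha hb hab))

/-- The extension of `A ↦ [A]` to a homomorphism on words over `𝓕`. -/
def traceOfSets (W : List D.IndepSet) : D.Trace := (W.map D.traceOfSet).prod

/-- `A₁ A₂ ⋯ Aₙ` is in extended Foata normal form if every letter in `Aᵢ₊₁` depends on some
letter in `Aᵢ`, for all `1 ≤ i < n`. -/
def IsExtFoata (W : List D.IndepSet) : Prop :=
  W.IsChain (fun A B => ∀ b ∈ B.1, ∃ a ∈ A.1, D.Dep a b)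

/-- The language `L_R` over the alphabet `𝓕 × 𝓕`: all words whose two components are in extended
Foata normal form and represent a pair of traces in `R`. -/
def foataLanguage (R : Set (D.Trace × D.Trace)) : Language (D.IndepSet × D.IndepSet) :=
  {W | D.IsExtFoata (W.map Prod.fst) ∧ D.IsExtFoata (W.map Prod.snd) ∧
    (D.traceOfSets (W.map Prod.fst), D.traceOfSets (W.map Prod.snd)) ∈ R}

/-- A binary trace relation `R` is fnf-automatic if the language `L_R` is regular. -/
def IsFnfAutomatic (R : Set (D.Trace × D.Trace)) : Prop := (D.foataLanguage R).IsRegular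

/-- The product `R · (K × L)`. -/
def mulProd (R : Set (D.Trace × D.Trace)) (K L : Set D.Trace) : Set (D.Trace × D.Trace) :=
  {p | ∃ x₁ x₂ y z, (x₁, x₂) ∈ R ∧ y ∈ K ∧ z ∈ L ∧ p = (x₁ * y, x₂ * z)}

end Dependence

/-! ### Finite presentations, as inputs and outputs of algorithms -/

/-- A finite description of an NFA: the list of initial states, the list of transitions
`(p, b, q)` with `b` describing a letter, and the list of final states.  States are natural
numbers, of which only finitely many occur. -/
abbrev NFACode (β : Type) : Type := List ℕ × List (ℕ × β × ℕ) × List ℕ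

namespace NFACode

variable {β : Type} {α : Type u}

/-- The automaton over the alphabet `α` described by a code, where `r b a` means that `b`
describes the letter `a`. -/
def toNFA (r : β → α → Prop) (c : NFACode β) : NFA α ℕ where
  step p a := {q | ∃ b, r b a ∧ (p, b, q) ∈ c.2.1}
  start := {p | p ∈ c.1}
  accept := {p | p ∈ c.2.2}

/-- The code `c` describes an NFA over the alphabet `α` (every transition is labelled by a
letter) that accepts the language `L`. -/
def Presents (r : β → α → Prop) (c : NFACode β) (L : Language α) : Prop :=
  (∀ t ∈ c.2.1, ∃ a, r t.2.1 a) ∧ (c.toNFA r).accepts = L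

end NFACode

/-- The number `b` describes the letter `a` of the alphabet `Fin n`. -/
def DescribesLetter {n : ℕ} (b : ℕ) (a : Fin n) : Prop := b = a

/-- The pair `b` of lists of numbers describes the pair `A` of independent sets: the lists
enumerate, in any order, the elements of the two sets. -/
def DescribesSets {n : ℕ} (D : Dependence (Fin n)) (b : List ℕ × List ℕ)
    (A : D.IndepSet × D.IndepSet) : Prop :=
  b.1.toFinset = A.1.1.map Fin.valEmbedding ∧ b.2.toFinset = A.2.1.map Fin.valEmbedding

/-- The list `d` of pairs of numbers describes the dependence relation `D`. -/
def DescribesDependence {n : ℕ} (d : List (ℕ × ℕ)) (D : Dependence (Fin n)) : Prop :=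
  ∀ a b : Fin n, D.Dep a b ↔ ((a : ℕ), (b : ℕ)) ∈ d

end FoataTrace

open FoataTrace

namespace FoataTrace

universe u v w

namespace Dependence

variable {α : Type u} (D : Dependence α)

/-! ### Words and traces -/

/-! Suppose that an extended Foata normal form `A₁ ⋯ Aₙ` represents a product `x * y`. Carrying a
word for `x` followed by a word for `y` along exchanges of independent letters marks each letter
occurrence as prefix or suffix, such that no prefix letter depends on an earlier suffix letter
(`exists_prefixMarking`). Deleting the suffix letters from each `Aᵢ` leaves a word in extended Foata
normal form again: a letter of `Aᵢ` on which a prefix letter of `Aᵢ₊₁` depends cannot itself be a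
suffix letter. This word represents `x` and, since empty sets are allowed, has the same length `n`.

Such a splitting can be guessed with finite memory. As `D` is reflexive, once a letter has been put
into the suffix, all its later occurrences are suffix letters too. It is therefore enough to
remember the last set read, a growing set `S` of suffix letters, and a state of the automaton for
the suffix; from `A` the part `A \ S` goes to the prefix and `A ∩ S` to the suffix. Conversely,
every run of this automaton is a factorization, because the suffix letters commute with all prefix
letters that follow (`SplitRun.exists_suffix`); completeness is `exists_splitRun`.

Since lengths are preserved, both components can be split in parallel while the automaton for `L_R`
reads the pair of prefixes (`accepts_mulProdNFA`). This gives regularity. For effectiveness, sets of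
letters become sublists of `[0, …, n - 1]`, and the whole construction is a primitive recursive
function on codes (`primrec_mulProdCode`). The computed automaton is the image of the abstract one,
restricted to listed states, under an injective encoding (`accepts_mulProdCode`). -/

theorem traceOfWord_nil : D.traceOfWord [] = 1 := map_one _

theorem traceOfWord_append (u v : List α) :
    D.traceOfWord (u ++ v) = D.traceOfWord u * D.traceOfWord v := map_mul _ _ _

theorem traceOfWord_cons (a : α) (v : List α) :
    D.traceOfWord (a :: v) = D.traceOfWord [a] * D.traceOfWord v :=
  D.traceOfWord_append [a] v

theorem traceOfWord_surjective : Function.Surjective D.traceOfWord := fun x =>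
  PresentedMonoid.inductionOn x fun w => ⟨FreeMonoid.toList w, rfl⟩

theorem indep_of_not_dep {a b : α} (h : ¬ D.Dep a b) : D.Indep a b :=
  ⟨fun e => h (e ▸ D.refl a), h⟩

theorem Indep.symm {D : Dependence α} {a b : α} (h : D.Indep a b) : D.Indep b a :=
  ⟨h.1.symm, fun e => h.2 (D.symm _ _ e)⟩

theorem commute_traceOfWord {u v : List α} (h : ∀ a ∈ u, ∀ b ∈ v, D.Indep a b) :
    Commute (D.traceOfWord u) (D.traceOfWord v) := by
  induction u with
  | nil => rw [traceOfWord_nil]; exact Commute.one_left _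
  | cons a u ih =>
    rw [traceOfWord_cons]
    refine Commute.mul_left ?_ (ih fun c hc => h c (List.mem_cons_of_mem _ hc))
    have ha := h a List.mem_cons_self
    clear ih h
    induction v with
    | nil => rw [traceOfWord_nil]; exact Commute.one_right _
    | cons b v ih =>
      rw [D.traceOfWord_cons b]
      exact (D.commute_of_indep (ha b List.mem_cons_self)).mul_right
        (ih fun c hc => ha c (List.mem_cons_of_mem _ hc))

/-- One exchange of two adjacent independent letters. -/
def Swap (u v : List α) : Prop :=
  ∃ l r a b, D.Indep a b ∧ u = l ++ a :: b :: r ∧ v = l ++ b :: a :: r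

variable {D} in
theorem Swap.append_left {u v : List α} (h : D.Swap u v) (t : List α) :
    D.Swap (t ++ u) (t ++ v) := by
  obtain ⟨l, r, a, b, hab, rfl, rfl⟩ := h
  exact ⟨t ++ l, r, a, b, hab, by simp, by simp⟩

variable {D} in
theorem Swap.append_right {u v : List α} (h : D.Swap u v) (t : List α) :
    D.Swap (u ++ t) (v ++ t) := by
  obtain ⟨l, r, a, b, hab, rfl, rfl⟩ := h
  exact ⟨l, r ++ t, a, b, hab, by simp, by simp⟩

variable {D} in
theorem Swap.symm {u v : List α} (h : D.Swap u v) : D.Swap v u := by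
  obtain ⟨l, r, a, b, hab, rfl, rfl⟩ := h
  exact ⟨l, r, b, a, hab.symm, rfl, rfl⟩

/-- The congruence on the free monoid generated by exchanges of independent letters. -/
def swapCon : Con (FreeMonoid α) where
  r u v := Relation.ReflTransGen D.Swap u.toList v.toList
  iseqv :=
    { refl := fun _ => .refl
      symm := fun h => Relation.ReflTransGen.swap _ _
        (Relation.ReflTransGen.mono (fun _ _ => Swap.symm) _ _ h)
      trans := Relation.ReflTransGen.trans }
  mul' := fun {w x y z} h₁ h₂ => by
    have e₁ : Relation.ReflTransGen D.Swap (w.toList ++ y.toList) (x.toList ++ y.toList) :=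
      h₁.lift (· ++ y.toList) fun _ _ h => h.append_right _
    have e₂ : Relation.ReflTransGen D.Swap (x.toList ++ y.toList) (x.toList ++ z.toList) :=
      h₂.lift (x.toList ++ ·) fun _ _ h => h.append_left _
    exact e₁.trans e₂

/-- Chains of exchanges already form a congruence containing the defining relations, so the least
such congruence lies below it. -/
theorem reflTransGen_swap_of_traceOfWord_eq {u v : List α}
    (h : D.traceOfWord u = D.traceOfWord v) : Relation.ReflTransGen D.Swap u v := by
  have h' : conGen D.commRel (FreeMonoid.ofList u) (FreeMonoid.ofList v) :=
    PresentedMonoid.mk_eq_mk_iff.1 h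
  have hle : conGen D.commRel ≤ D.swapCon := by
    refine Con.conGen_le.2 ?_
    rintro _ _ ⟨a, b, hab, rfl, rfl⟩
    exact Relation.ReflTransGen.single ⟨[], [], a, b, hab, rfl, rfl⟩
  exact hle h'

/-! ### Words whose letters are marked as belonging to a prefix or to a suffix -/

/-- In a word whose letters are marked, no letter marked `true` depends on an earlier letter
marked `false`. -/
def IsPrefixMarking (m : List (α × Bool)) : Prop :=
  m.Pairwise fun p q => p.2 = false → q.2 = true → ¬ D.Dep p.1 q.1

/-- The letters of a marked word that carry the given mark. -/
def marked (c : Bool) (m : List (α × Bool)) : List α := (m.filter (·.2 == c)).map Prod.fst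

theorem marked_append (c : Bool) (m m' : List (α × Bool)) :
    marked c (m ++ m') = marked c m ++ marked c m' := by
  simp [marked]

/-- When the mark depends on the letter alone, as it does within a single set of a Foata normal
form, the marked part is a filter of the word, with its order kept. -/
theorem marked_eq_filter {c : Bool} {f : α → Bool} {m : List (α × Bool)}
    (h : ∀ x ∈ m, x.2 = f x.1) : marked c m = (m.map Prod.fst).filter (f · == c) := by
  rw [List.filter_map, marked]
  congr 1
  exact List.filter_congr fun x hx => by simp [h x hx]

/-- If both letters carry the mark, two independent letters are exchanged; otherwise the selected
word does not change at all. -/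
theorem traceOfWord_marked_swap (c : Bool) (l r : List (α × Bool)) {p q : α × Bool}
    (h : D.Indep p.1 q.1) :
    D.traceOfWord (marked c (l ++ p :: q :: r)) = D.traceOfWord (marked c (l ++ q :: p :: r)) := by
  have e : D.traceOfWord (marked c [p, q]) = D.traceOfWord (marked c [q, p]) := by
    by_cases hp : p.2 = c <;> by_cases hq : q.2 = c <;> simp [marked, hp, hq]
    simpa [← traceOfWord_append, Commute, SemiconjBy] using D.commute_of_indep h
  have s : ∀ x y : α × Bool, l ++ x :: y :: r = l ++ ([x, y] ++ r) := by simp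
  simp only [s, marked_append, traceOfWord_append, e]

/-- A prefix marking is carried along by equivalence of words. -/
theorem exists_prefixMarking_of_swaps {u v : List α} (h : Relation.ReflTransGen D.Swap u v)
    {m : List (α × Bool)} (hm : m.map Prod.fst = u) (hp : D.IsPrefixMarking m) :
    ∃ m' : List (α × Bool), m'.map Prod.fst = v ∧ D.IsPrefixMarking m' ∧
      ∀ c, D.traceOfWord (marked c m') = D.traceOfWord (marked c m) := by
  induction h with
  | refl => exact ⟨m, hm, hp, fun _ => rfl⟩
  | tail _ h ih =>
    obtain ⟨m', hm', hp', ht⟩ := ih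
    obtain ⟨l, r, a, b, hab, rfl, rfl⟩ := h
    obtain ⟨ml, m₁, rfl, hl, h₁⟩ := List.map_eq_append_iff.1 hm'
    obtain ⟨p, m₂, rfl, hpa, h₂⟩ := List.map_eq_cons_iff.1 h₁
    obtain ⟨q, mr, rfl, hqb, hr⟩ := List.map_eq_cons_iff.1 h₂
    refine ⟨ml ++ q :: p :: mr, by simp [*], ?_, fun c => ?_⟩
    -- Only the order of `p` and `q` changes, and this pair satisfies the condition whatever its
    -- marks.
    · have hba : ¬ D.Dep q.1 p.1 := by rw [hpa, hqb]; exact hab.symm.2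
      simp only [IsPrefixMarking, List.pairwise_append, List.pairwise_cons, List.mem_cons] at hp' ⊢
      grind
    · rw [← ht c]
      exact D.traceOfWord_marked_swap c ml mr (by rw [hpa, hqb]; exact hab.symm)

/-- The obvious marking of a word for `x` followed by a word for `y` is transported to `w`. -/
theorem exists_prefixMarking {w : List α} {x y : D.Trace} (h : D.traceOfWord w = x * y) :
    ∃ m : List (α × Bool), m.map Prod.fst = w ∧ D.IsPrefixMarking m ∧
      D.traceOfWord (marked true m) = x ∧ D.traceOfWord (marked false m) = y := by
  obtain ⟨u, rfl⟩ := D.traceOfWord_surjective x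
  obtain ⟨v, rfl⟩ := D.traceOfWord_surjective y
  rw [← traceOfWord_append] at h
  obtain ⟨m, hm, hp, ht⟩ := D.exists_prefixMarking_of_swaps
    (D.reflTransGen_swap_of_traceOfWord_eq h.symm)
    (m := u.map (·, true) ++ v.map (·, false)) (by simp [Function.comp_def])
    (by
      simp only [IsPrefixMarking, List.pairwise_append, List.pairwise_map]
      exact ⟨List.pairwise_of_forall (by simp), List.pairwise_of_forall (by simp), by simp⟩)
  refine ⟨m, hm, hp, ?_, ?_⟩ <;> rw [ht] <;> simp [marked, List.filter_map, Function.comp_def]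

/-! ### Independent sets -/

theorem traceOfWord_eq_prod (w : List α) :
    D.traceOfWord w = (w.map fun a => D.traceOfWord [a]).prod := by
  induction w with
  | nil => exact D.traceOfWord_nil
  | cons a w ih => rw [traceOfWord_cons, ih, List.map_cons, List.prod_cons]

variable [DecidableEq α]

/-- The letters of an independent set that do not belong to `S`. -/
def IndepSet.sdiff {D : Dependence α} (A : D.IndepSet) (S : Finset α) : D.IndepSet :=
  ⟨A.1 \ S, A.2.mono fun _ h => (Finset.mem_sdiff.1 h).1⟩

/-- The elements of a set of letters, in the order in which they occur in `E`. -/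
def enum (E : List α) (A : Finset α) : List α := E.filter (· ∈ A)

theorem mem_enum {E : List α} (hE : ∀ a, a ∈ E) {A : Finset α} {a : α} : a ∈ enum E A ↔ a ∈ A := by
  simp [enum, hE]

theorem nodup_enum {E : List α} (hE : E.Nodup) (A : Finset α) : (enum E A).Nodup := hE.filter _

theorem traceOfSet_eq {A : D.IndepSet} {w : List α} (hw : w.Nodup) (h : w.toFinset = A.1) :
    D.traceOfSet A = D.traceOfWord w := by
  obtain ⟨A, hA⟩ := A
  subst h
  rw [traceOfWord_eq_prod]
  exact Finset.noncommProd_toFinset w _ _ hw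

theorem traceOfSet_eq_enum {E : List α} (hE : E.Nodup) (hE' : ∀ a, a ∈ E) (A : D.IndepSet) :
    D.traceOfSet A = D.traceOfWord (enum E A.1) :=
  D.traceOfSet_eq (nodup_enum hE _) (by ext; simp [mem_enum hE'])

theorem traceOfSets_eq_enum {E : List α} (hE : E.Nodup) (hE' : ∀ a, a ∈ E) (W : List D.IndepSet) :
    D.traceOfSets W = D.traceOfWord (W.flatMap fun A => enum E A.1) := by
  induction W with
  | nil => exact D.traceOfWord_nil.symm
  | cons A W ih =>
    rw [List.flatMap_cons, traceOfWord_append, ← ih, ← D.traceOfSet_eq_enum hE hE']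
    simp [traceOfSets]

theorem traceOfSet_eq_sdiff_mul {E : List α} (hE : E.Nodup) (hE' : ∀ a, a ∈ E) (A : D.IndepSet)
    (S : Finset α) :
    D.traceOfSet A = D.traceOfSet (A.sdiff S) * D.traceOfWord (enum E (A.1 ∩ S)) := by
  rw [D.traceOfSet_eq_enum hE hE' (A.sdiff S), ← traceOfWord_append]
  refine D.traceOfSet_eq (List.Nodup.append (nodup_enum hE _) (nodup_enum hE _) ?_) ?_
  · intro a
    simp only [mem_enum hE', IndepSet.sdiff]
    grind
  · ext a
    simp only [List.mem_toFinset, List.mem_append, mem_enum hE', IndepSet.sdiff]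
    grind

end Dependence

theorem mem_acceptsFrom_iff_exists {α : Type u} {σ : Type v} (M : NFA α σ) {S : Set σ}
    {w : List α} : w ∈ M.acceptsFrom S ↔ ∃ s ∈ S, w ∈ M.acceptsFrom {s} := by
  simp only [NFA.mem_acceptsFrom]
  constructor
  · rintro ⟨t, ht, h⟩
    obtain ⟨s, hs, h⟩ := NFA.mem_evalFrom_iff_exists.1 h
    exact ⟨s, hs, t, ht, h⟩
  · rintro ⟨s, hs, t, ht, h⟩
    exact ⟨t, ht, NFA.mem_evalFrom_iff_exists.2 ⟨s, hs, h⟩⟩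

namespace Dependence

variable {α : Type u} (D : Dependence α) [DecidableEq α]

/-! ### Splitting off a prefix of a trace in Foata normal form

A state `(A, S, s)` consists of the set `A` of letters read last, a set `S` that contains all
letters that were assigned to the suffix, and a state `s` of an automaton reading the suffix. -/

/-- A step of the splitting automaton: the letters of `q.1` that belong to `q.2.1` are assigned to
the suffix, the others to the prefix. -/
def SplitStep {σ : Type v} (E : List α) (M : NFA α σ) (p q : Finset α × Finset α × σ) : Prop :=
  (∀ b ∈ q.1, ∃ a ∈ p.1, D.Dep a b) ∧ p.2.1 ⊆ q.2.1 ∧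
    (∀ b ∈ q.1, b ∉ q.2.1 → ∀ a ∈ p.2.1, ¬ D.Dep a b) ∧
    q.2.2 ∈ M.evalFrom {p.2.2} (enum E (q.1 ∩ q.2.1))

/-- `D.SplitRun E M p W X` means that the splitting automaton, started in `p`, can read `W` such
that the prefix is `X` and the suffix is accepted by `M`. -/
def SplitRun {σ : Type v} (E : List α) (M : NFA α σ) :
    Finset α × Finset α × σ → List D.IndepSet → List D.IndepSet → Prop
  | p, [], X => X = [] ∧ p.2.2 ∈ M.accept
  | p, A :: W, X => ∃ q X', q.1 = A.1 ∧ D.SplitStep E M p q ∧ X = A.sdiff q.2.1 :: X' ∧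
      SplitRun E M q W X'

variable {σ : Type v} {E : List α} {M : NFA α σ}

variable {D} in
theorem SplitRun.length_eq {W : List D.IndepSet} : ∀ {p X}, D.SplitRun E M p W X →
    X.length = W.length := by
  induction W with
  | nil => rintro p X ⟨rfl, -⟩; rfl
  | cons A W ih =>
    rintro p X ⟨q, X', -, -, rfl, h⟩
    simp [ih h]

variable {D} in
-- The second component only grows along a run, so the local condition in each step persists for
-- everything read later.
theorem SplitRun.not_dep {W : List D.IndepSet} : ∀ {p X}, D.SplitRun E M p W X →
    ∀ B ∈ X, ∀ b ∈ B.1, ∀ a ∈ p.2.1, ¬ D.Dep a b := by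
  induction W with
  | nil => rintro p X ⟨rfl, -⟩; simp
  | cons A W ih =>
    rintro p X ⟨q, X', hq, ⟨-, hs, hd, -⟩, rfl, h⟩ B hB b hb a ha
    rcases List.mem_cons.1 hB with rfl | hB
    · obtain ⟨h₁, h₂⟩ := Finset.mem_sdiff.1 hb
      exact hd b (hq ▸ h₁) h₂ a ha
    · exact ih h B hB b hb a (hs ha)

variable {D} in
-- The statement about the head links the word to the set stored in `p`, as the induction requires.
theorem SplitRun.isExtFoata {W : List D.IndepSet} : ∀ {p X}, D.SplitRun E M p W X →
    D.IsExtFoata W ∧ ∀ A ∈ W.head?, ∀ b ∈ A.1, ∃ a ∈ p.1, D.Dep a b := by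
  induction W with
  | nil => rintro p X -; simp [IsExtFoata]
  | cons A W ih =>
    rintro p X ⟨q, X', hq, ⟨hc, -, -, -⟩, rfl, h⟩
    obtain ⟨h₁, h₂⟩ := ih h
    rw [hq] at h₂ hc
    refine ⟨List.isChain_cons.2 ⟨fun B hB b hb => h₂ B hB b hb, h₁⟩, ?_⟩
    rintro B hB
    obtain rfl : A = B := by simpa using hB
    exact hc

variable {D} in
-- A prefix letter depends on some letter of the preceding set; that letter lies outside `p.2.1`, on
-- which prefix letters do not depend, so it survives the deletion.
theorem SplitRun.isExtFoata_prefix {W : List D.IndepSet} : ∀ {p X}, D.SplitRun E M p W X →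
    D.IsExtFoata X ∧ ∀ B ∈ X.head?, ∀ b ∈ B.1, ∃ a ∈ p.1 \ p.2.1, D.Dep a b := by
  induction W with
  | nil => rintro p X ⟨rfl, -⟩; simp [IsExtFoata]
  | cons A W ih =>
    rintro p X ⟨q, X', hq, ⟨hc, hs, hd, hM⟩, rfl, h⟩
    obtain ⟨h₁, h₂⟩ := ih h
    refine ⟨List.isChain_cons.2 ⟨fun B hB b hb => ?_, h₁⟩, ?_⟩
    · obtain ⟨a, ha, hab⟩ := h₂ B hB b hb
      exact ⟨a, by simpa [IndepSet.sdiff, hq] using ha, hab⟩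
    · rintro B hB b hb
      obtain rfl : A.sdiff q.2.1 = B := by simpa using hB
      obtain ⟨hbA, hbS⟩ := Finset.mem_sdiff.1 hb
      obtain ⟨a, ha, hab⟩ := hc b (hq ▸ hbA)
      exact ⟨a, Finset.mem_sdiff.2 ⟨ha, fun h => hd b (hq ▸ hbA) hbS a h hab⟩, hab⟩

variable {D} in
/-- The prefix found by the splitting automaton, multiplied by the suffix, is the trace read. -/
theorem SplitRun.exists_suffix (hE : E.Nodup) (hE' : ∀ a, a ∈ E) {W : List D.IndepSet} :
    ∀ {p X}, D.SplitRun E M p W X →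
      ∃ w ∈ M.acceptsFrom {p.2.2}, D.traceOfSets W = D.traceOfSets X * D.traceOfWord w := by
  induction W with
  | nil =>
    rintro p X ⟨rfl, h⟩
    exact ⟨[], by simpa using h, by simp [traceOfWord_nil, traceOfSets]⟩
  | cons A W ih =>
    rintro p X ⟨q, X', hq, ⟨-, -, -, hM⟩, rfl, h⟩
    obtain ⟨w, hw, e⟩ := ih h
    refine ⟨enum E (A.1 ∩ q.2.1) ++ w, ?_, ?_⟩
    · rw [NFA.append_mem_acceptsFrom, mem_acceptsFrom_iff_exists]
      exact ⟨q.2.2, hq ▸ hM, hw⟩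
    -- The suffix letters of `A` have to be moved to the right past the rest of the prefix.
    · have hcomm : Commute (D.traceOfWord (enum E (A.1 ∩ q.2.1))) (D.traceOfSets X') := by
        rw [D.traceOfSets_eq_enum hE hE']
        refine D.commute_traceOfWord fun a ha b hb => D.indep_of_not_dep ?_
        obtain ⟨B, hB, hb⟩ := List.mem_flatMap.1 hb
        exact h.not_dep B hB b ((mem_enum hE').1 hb) a
          (Finset.mem_inter.1 ((mem_enum hE').1 ha)).2
      have e₁ : D.traceOfSets (A :: W) = D.traceOfSet A * D.traceOfSets W := by simp [traceOfSets]
      have e₂ : D.traceOfSets (A.sdiff q.2.1 :: X') =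
          D.traceOfSet (A.sdiff q.2.1) * D.traceOfSets X' := by simp [traceOfSets]
      rw [e₁, e₂, e, D.traceOfSet_eq_sdiff_mul hE hE' A q.2.1, traceOfWord_append]
      simp only [mul_assoc]
      rw [← mul_assoc (D.traceOfWord _) (D.traceOfSets X'), hcomm.eq, mul_assoc]

/-- Every prefix marking of the letters of a Foata normal form is found by the splitting
automaton. -/
theorem exists_splitRun_of_marking (hE : E.Nodup) (hE' : ∀ a, a ∈ E) (W : List D.IndepSet) :
    ∀ (p : Finset α × Finset α × σ) (m : List (α × Bool)),
      m.map Prod.fst = W.flatMap (fun A => enum E A.1) → D.IsPrefixMarking m →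
      (∀ x ∈ m, x.2 = true → ∀ a ∈ p.2.1, ¬ D.Dep a x.1) →
      (∀ A ∈ W.head?, ∀ b ∈ A.1, ∃ a ∈ p.1, D.Dep a b) → D.IsExtFoata W →
      marked false m ∈ M.acceptsFrom {p.2.2} →
      ∃ X, D.SplitRun E M p W X ∧ X.flatMap (fun A => enum E A.1) = marked true m := by
  induction W with
  | nil =>
    intro p m hm _ _ _ _ hacc
    obtain rfl : m = [] := by simpa using hm
    exact ⟨[], ⟨rfl, by simpa [marked] using hacc⟩, rfl⟩
  | cons A W ih =>
    intro p m hm hpm hS hhead hW hacc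
    rw [List.flatMap_cons] at hm
    obtain ⟨m₁, m₂, rfl, h₁, h₂⟩ := List.map_eq_append_iff.1 hm
    obtain ⟨-, hpm₂, hcross⟩ := List.pairwise_append.1 hpm
    obtain ⟨hWhead, hW⟩ := List.isChain_cons.1 hW
    -- The smallest possible choice: the old suffix letters and those marked in the set now being
    -- read.
    set S := p.2.1 ∪ (marked false m₁).toFinset with hSdef
    have hmem : ∀ a, a ∈ S ↔ a ∈ p.2.1 ∨ (a, false) ∈ m₁ := by
      intro a; simp [hSdef, marked]
    have hnd : (m₁.map Prod.fst).Nodup := h₁ ▸ nodup_enum hE _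
    -- A prefix letter is not an old suffix letter by reflexivity of `D`, nor a new one because each
    -- letter occurs at most once in `m₁`.
    have hmark : ∀ x ∈ m₁, x.2 = decide (x.1 ∉ S) := by
      rintro ⟨a, c⟩ hx
      cases c with
      | false => simp [(hmem a).2 (Or.inr hx)]
      | true =>
        have : a ∉ S := by
          rw [hmem]
          rintro (h | h)
          · exact hS _ (List.mem_append_left _ hx) rfl a h (D.refl a)
          · simpa using List.inj_on_of_nodup_map hnd hx h rfl
        simp [this]
    have hmt : marked true m₁ = enum E (A.sdiff S).1 := by
      rw [marked_eq_filter (f := fun a => decide (a ∉ S)) hmark, h₁, enum, enum, List.filter_filter]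
      exact List.filter_congr fun a _ => by simp [IndepSet.sdiff, Bool.and_comm]
    have hmf : marked false m₁ = enum E (A.1 ∩ S) := by
      rw [marked_eq_filter (f := fun a => decide (a ∉ S)) hmark, h₁, enum, enum, List.filter_filter]
      exact List.filter_congr fun a _ => by simp [Bool.and_comm]
    rw [marked_append, NFA.append_mem_acceptsFrom, mem_acceptsFrom_iff_exists] at hacc
    obtain ⟨s, hs, hacc⟩ := hacc
    obtain ⟨X, hX, hXm⟩ := ih (A.1, S, s) m₂ h₂ hpm₂ (fun x hx hxt a ha => by
      rcases (hmem a).1 ha with h | h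
      · exact hS x (List.mem_append_right _ hx) hxt a h
      · exact hcross _ h x hx rfl hxt) hWhead hW hacc
    refine ⟨A.sdiff S :: X, ⟨(A.1, S, s), X, rfl, ⟨?_, Finset.subset_union_left, ?_, ?_⟩, rfl, hX⟩,
      ?_⟩
    · exact hhead A (by simp)
    · intro b hb hbS a ha
      have hb' : b ∈ marked true m₁ := by
        rw [hmt, mem_enum hE']; exact Finset.mem_sdiff.2 ⟨hb, hbS⟩
      obtain ⟨x, hx, rfl⟩ := List.mem_map.1 hb'
      obtain ⟨hx, hxt⟩ := List.mem_filter.1 hx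
      exact hS x (List.mem_append_left _ hx) (by simpa using hxt) a ha
    · rw [← hmf]; exact hs
    · rw [List.flatMap_cons, hXm, marked_append, hmt]

/-- A Foata normal form of a product `x * y` splits into the Foata normal form of `x` and a
word for `y`. -/
theorem exists_splitRun (hE : E.Nodup) (hE' : ∀ a, a ∈ E) {K : Set D.Trace}
    (hM : M.accepts = D.wordLanguage K) {W : List D.IndepSet} (hW : D.IsExtFoata W)
    {x y : D.Trace} (hy : y ∈ K) (h : D.traceOfSets W = x * y) :
    ∃ s ∈ M.start, ∃ X, D.SplitRun E M (E.toFinset, ∅, s) W X ∧ D.traceOfSets X = x := by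
  rw [D.traceOfSets_eq_enum hE hE'] at h
  obtain ⟨m, hm, hpm, hx, hy'⟩ := D.exists_prefixMarking h
  have hacc : marked false m ∈ M.accepts := by
    rw [hM]; change D.traceOfWord _ ∈ K; rwa [hy']
  rw [NFA.accepts_eq_acceptsFrom_start, mem_acceptsFrom_iff_exists] at hacc
  obtain ⟨s, hs, hacc⟩ := hacc
  -- With all letters stored as the set read last, reflexivity of `D` makes the first set of `W`
  -- unconstrained.
  obtain ⟨X, hX, hXm⟩ := D.exists_splitRun_of_marking hE hE' W (E.toFinset, ∅, s) m hm hpm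
    (by simp) (fun A _ b _ => ⟨b, by simp [hE'], D.refl b⟩) hW hacc
  exact ⟨s, hs, X, hX, by rw [D.traceOfSets_eq_enum hE hE', hXm, hx]⟩

/-! ### The automaton for the product -/

variable {τ : Type v} {ρ : Type w}

/-- The automaton that splits both components of its input and reads the pair of prefixes with
`MR` and the two suffixes with `M` and `N`. -/
def mulProdNFA (E : List α) (MR : NFA (D.IndepSet × D.IndepSet) ρ) (M : NFA α σ) (N : NFA α τ) :
    NFA (D.IndepSet × D.IndepSet)
      ((Finset α × Finset α × σ) × (Finset α × Finset α × τ) × ρ) where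
  step p A := {q | q.1.1 = A.1.1 ∧ q.2.1.1 = A.2.1 ∧ D.SplitStep E M p.1 q.1 ∧
    D.SplitStep E N p.2.1 q.2.1 ∧
    q.2.2 ∈ MR.step p.2.2 (A.1.sdiff q.1.2.1, A.2.sdiff q.2.1.2.1)}
  start := {p | (p.1.1 = E.toFinset ∧ p.1.2.1 = ∅ ∧ p.1.2.2 ∈ M.start) ∧
    (p.2.1.1 = E.toFinset ∧ p.2.1.2.1 = ∅ ∧ p.2.1.2.2 ∈ N.start) ∧ p.2.2 ∈ MR.start}
  accept := {p | p.1.2.2 ∈ M.accept ∧ p.2.1.2.2 ∈ N.accept ∧ p.2.2 ∈ MR.accept}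

variable {MR : NFA (D.IndepSet × D.IndepSet) ρ} {N : NFA α τ}

/-- The product automaton runs three machines in lockstep; `V` is the word of prefix pairs that it
feeds to `MR`. -/
theorem mem_acceptsFrom_mulProdNFA (W : List (D.IndepSet × D.IndepSet)) : ∀ p,
    W ∈ (D.mulProdNFA E MR M N).acceptsFrom {p} ↔
      ∃ V, D.SplitRun E M p.1 (W.map Prod.fst) (V.map Prod.fst) ∧
        D.SplitRun E N p.2.1 (W.map Prod.snd) (V.map Prod.snd) ∧ V ∈ MR.acceptsFrom {p.2.2} := by
  induction W with
  | nil =>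
    intro p
    simp only [NFA.nil_mem_acceptsFrom, Set.mem_singleton_iff, exists_eq_left, List.map_nil,
      SplitRun, List.map_eq_nil_iff]
    constructor
    · rintro ⟨h₁, h₂, h₃⟩
      exact ⟨[], ⟨rfl, h₁⟩, ⟨rfl, h₂⟩, by simpa using h₃⟩
    · rintro ⟨V, ⟨rfl, h₁⟩, ⟨-, h₂⟩, h₃⟩
      exact ⟨h₁, h₂, by simpa using h₃⟩
  | cons A W ih =>
    intro p
    rw [NFA.cons_mem_acceptsFrom, NFA.stepSet_singleton, mem_acceptsFrom_iff_exists]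
    constructor
    · rintro ⟨q, ⟨hA₁, hA₂, h₁, h₂, hR⟩, hq⟩
      obtain ⟨V, hV₁, hV₂, hV⟩ := (ih q).1 hq
      refine ⟨(A.1.sdiff q.1.2.1, A.2.sdiff q.2.1.2.1) :: V, ⟨q.1, _, hA₁, h₁, rfl, hV₁⟩,
        ⟨q.2.1, _, hA₂, h₂, rfl, hV₂⟩, ?_⟩
      rw [NFA.cons_mem_acceptsFrom, NFA.stepSet_singleton, mem_acceptsFrom_iff_exists]
      exact ⟨q.2.2, hR, hV⟩
    · rintro ⟨V, ⟨q₁, X, hA₁, h₁, hX, hV₁⟩, ⟨q₂, Z, hA₂, h₂, hZ, hV₂⟩, hV⟩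
      obtain ⟨v, V, rfl, hv, rfl⟩ := List.map_eq_cons_iff.1 hX
      obtain ⟨hv', rfl⟩ := List.cons_eq_cons.1 hZ
      rw [NFA.cons_mem_acceptsFrom, NFA.stepSet_singleton, mem_acceptsFrom_iff_exists] at hV
      obtain ⟨r, hr, hV⟩ := hV
      refine ⟨(q₁, q₂, r), ⟨hA₁, hA₂, h₁, h₂, ?_⟩, (ih _).2 ⟨V, hV₁, hV₂, hV⟩⟩
      rwa [← hv, ← hv']

theorem accepts_mulProdNFA (hE : E.Nodup) (hE' : ∀ a, a ∈ E) {R : Set (D.Trace × D.Trace)}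
    {K L : Set D.Trace} (hR : MR.accepts = D.foataLanguage R) (hK : M.accepts = D.wordLanguage K)
    (hL : N.accepts = D.wordLanguage L) :
    (D.mulProdNFA E MR M N).accepts = D.foataLanguage (D.mulProd R K L) := by
  ext W
  rw [NFA.accepts_eq_acceptsFrom_start, mem_acceptsFrom_iff_exists]
  constructor
  · rintro ⟨⟨⟨_, _, s⟩, ⟨_, _, t⟩, r⟩, ⟨⟨rfl, rfl, hs⟩, ⟨rfl, rfl, ht⟩, hr⟩, h⟩
    obtain ⟨V, h₁, h₂, h₃⟩ := (D.mem_acceptsFrom_mulProdNFA W _).1 h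
    have hV : V ∈ D.foataLanguage R := by
      rw [← hR, NFA.accepts_eq_acceptsFrom_start, mem_acceptsFrom_iff_exists]
      exact ⟨r, hr, h₃⟩
    obtain ⟨y, hy, e₁⟩ := h₁.exists_suffix hE hE'
    obtain ⟨z, hz, e₂⟩ := h₂.exists_suffix hE hE'
    have hy' : y ∈ D.wordLanguage K := by
      rw [← hK, NFA.accepts_eq_acceptsFrom_start, mem_acceptsFrom_iff_exists]
      exact ⟨s, hs, hy⟩
    have hz' : z ∈ D.wordLanguage L := by
      rw [← hL, NFA.accepts_eq_acceptsFrom_start, mem_acceptsFrom_iff_exists]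
      exact ⟨t, ht, hz⟩
    exact ⟨h₁.isExtFoata.1, h₂.isExtFoata.1, _, _, _, _, hV.2.2, hy', hz', Prod.ext e₁ e₂⟩
  · rintro ⟨hW₁, hW₂, x₁, x₂, y, z, hx, hy, hz, e⟩
    obtain ⟨e₁, e₂⟩ := Prod.ext_iff.1 e
    obtain ⟨s, hs, X, hX, hXx⟩ := D.exists_splitRun hE hE' hK hW₁ hy e₁
    obtain ⟨t, ht, Z, hZ, hZx⟩ := D.exists_splitRun hE hE' hL hW₂ hz e₂
    -- Splitting preserves length, so the two prefixes can be zipped without padding or truncation.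
    have hlen : X.length = Z.length := by simp [hX.length_eq, hZ.length_eq]
    have f₁ : (X.zip Z).map Prod.fst = X := List.map_fst_zip hlen.le
    have f₂ : (X.zip Z).map Prod.snd = Z := List.map_snd_zip hlen.ge
    have hV : X.zip Z ∈ MR.accepts := by
      rw [hR]
      refine ⟨?_, ?_, ?_⟩
      · rw [f₁]; exact hX.isExtFoata_prefix.1
      · rw [f₂]; exact hZ.isExtFoata_prefix.1
      · rwa [f₁, f₂, hXx, hZx]
    rw [NFA.accepts_eq_acceptsFrom_start, mem_acceptsFrom_iff_exists] at hV
    obtain ⟨r, hr, hV⟩ := hV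
    refine ⟨((E.toFinset, ∅, s), (E.toFinset, ∅, t), r),
      ⟨⟨rfl, rfl, hs⟩, ⟨rfl, rfl, ht⟩, hr⟩, (D.mem_acceptsFrom_mulProdNFA W _).2 ⟨X.zip Z, ?_, ?_, hV⟩⟩
    · rwa [f₁]
    · rwa [f₂]

end Dependence

/-- For finite automata the state type of `mulProdNFA` is finite, and the subset construction yields
a DFA. -/
theorem Dependence.isFnfAutomatic_mulProd {α : Type u} [Finite α] (D : Dependence α) {R : Set (D.Trace × D.Trace)} {K L : Set D.Trace}
    (hR : D.IsFnfAutomatic R) (hK : D.IsRecognizable K) (hL : D.IsRecognizable L) :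
    D.IsFnfAutomatic (D.mulProd R K L) := by
  classical
  have := Fintype.ofFinite α
  obtain ⟨ρ, _, MR, hMR⟩ := hR
  obtain ⟨σ, _, M, hM⟩ := hK
  obtain ⟨τ, _, N, hN⟩ := hL
  refine Language.isRegular_iff.2 ⟨_, inferInstance,
    (D.mulProdNFA Finset.univ.toList MR.toNFA M.toNFA N.toNFA).toDFA, ?_⟩
  rw [NFA.toDFA_correct]
  exact D.accepts_mulProdNFA (Finset.nodup_toList _) (by simp)
    (MR.toNFA_correct.trans hMR) (M.toNFA_correct.trans hM) (N.toNFA_correct.trans hN)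

/-! ### Computing the automaton for the product -/

/-- All sublists of `[0, …, n - 1]`. -/
def subsetLists (n : ℕ) : List (List ℕ) :=
  (List.range n).foldr (fun a l => l ++ l.map (a :: ·)) [[]]

theorem mem_subsetLists {n : ℕ} {l : List ℕ} : l ∈ subsetLists n ↔ l.Sublist (List.range n) := by
  have h : ∀ r : List ℕ, r.foldr (fun a l => l ++ l.map (a :: ·)) [[]] = r.sublists' := by
    intro r
    induction r with
    | nil => rfl
    | cons a r ih => rw [List.foldr_cons, ih, List.sublists'_cons]
  rw [subsetLists, h, List.mem_sublists']

/-! ### Runs of coded automata -/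

namespace NFACode

/-- The initial states of a code and the targets of its transitions. -/
def states {β : Type} (c : NFACode β) : List ℕ := c.1 ++ c.2.1.map (·.2.2)

/-- The states reached from `Q` by transitions labelled `a`. -/
def stepList (c : NFACode ℕ) (Q : List ℕ) (a : ℕ) : List ℕ :=
  (c.2.1.filter fun t => t.1 ∈ Q ∧ t.2.1 = a).map (·.2.2)

/-- The states reached from `Q` by reading `w`. -/
def evalList (c : NFACode ℕ) (Q w : List ℕ) : List ℕ := w.foldl c.stepList Q

theorem mem_evalList {n : ℕ} (c : NFACode ℕ) (w : List (Fin n)) : ∀ (Q : List ℕ) (s : ℕ),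
    s ∈ c.evalList Q (w.map Fin.val) ↔ s ∈ (c.toNFA DescribesLetter).evalFrom {q | q ∈ Q} w := by
  induction w with
  | nil => intro Q s; rfl
  | cons a w ih =>
    intro Q s
    have h : {q | q ∈ c.stepList Q a} = (c.toNFA DescribesLetter).stepSet {q | q ∈ Q} a := by
      ext q
      simp only [stepList, toNFA, DescribesLetter, NFA.mem_stepSet, Set.mem_ofPred_eq, List.mem_map,
        List.mem_filter, decide_eq_true_eq, Prod.exists]
      grind
    rw [NFA.evalFrom_cons, ← h, ← ih]
    rfl

theorem mem_states_of_step {α : Type u} {β : Type} {r : β → α → Prop} {c : NFACode β} {s t : ℕ}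
    {a : α} (h : t ∈ (c.toNFA r).step s a) : t ∈ c.states := by
  obtain ⟨b, -, h⟩ := h
  exact List.mem_append_right _ (List.mem_map.2 ⟨_, h, rfl⟩)

/-- This is what allows the computed automaton to use only finitely many of the natural numbers as
states. -/
theorem mem_states_of_evalFrom {α : Type u} {β : Type} {r : β → α → Prop} {c : NFACode β}
    (w : List α) : ∀ {S : Set ℕ} {t : ℕ}, (∀ s ∈ S, s ∈ c.states) →
      t ∈ (c.toNFA r).evalFrom S w → t ∈ c.states := by
  induction w with
  | nil => intro S t hS h; exact hS t h
  | cons a w ih =>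
    intro S t hS h
    rw [NFA.evalFrom_cons] at h
    refine ih (fun s hs => ?_) h
    obtain ⟨s', -, hs⟩ := NFA.mem_stepSet.1 hs
    exact mem_states_of_step hs

end NFACode

/-- Two automata have the same language if the second is the image of the first under a map that
is compatible with all reachable transitions. -/
theorem accepts_eq_of_map {α : Type u} {σ : Type v} {τ : Type w} (M : NFA α σ) (N : NFA α τ)
    (g : σ → τ) (I : Set σ) (hstart : N.start = g '' M.start) (hI : M.start ⊆ I)
    (hstepI : ∀ s ∈ I, ∀ a, M.step s a ⊆ I)
    (hstep : ∀ s ∈ I, ∀ a, N.step (g s) a = g '' M.step s a)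
    (hacc : ∀ s ∈ I, g s ∈ N.accept ↔ s ∈ M.accept) : N.accepts = M.accepts := by
  -- Whole sets of states are tracked: as the step sets correspond exactly under `g`, reading a
  -- letter commutes with taking images.
  have key : ∀ (w : List α) (S : Set σ), S ⊆ I →
      M.evalFrom S w ⊆ I ∧ N.evalFrom (g '' S) w = g '' M.evalFrom S w := by
    intro w
    induction w with
    | nil => exact fun S hS => ⟨hS, rfl⟩
    | cons a w ih =>
      intro S hS
      have h₁ : M.stepSet S a ⊆ I := by
        intro t ht
        obtain ⟨s, hs, ht⟩ := NFA.mem_stepSet.1 ht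
        exact hstepI s (hS hs) a ht
      have h₂ : N.stepSet (g '' S) a = g '' M.stepSet S a := by
        ext t
        simp only [NFA.mem_stepSet, Set.mem_image]
        constructor
        · rintro ⟨_, ⟨s, hs, rfl⟩, ht⟩
          rw [hstep s (hS hs)] at ht
          obtain ⟨t, ht, rfl⟩ := ht
          exact ⟨t, ⟨s, hs, ht⟩, rfl⟩
        · rintro ⟨t, ⟨s, hs, ht⟩, rfl⟩
          exact ⟨g s, ⟨s, hs, rfl⟩, by rw [hstep s (hS hs)]; exact ⟨t, ht, rfl⟩⟩
      rw [NFA.evalFrom_cons, NFA.evalFrom_cons, h₂]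
      exact ih _ h₁
  ext w
  obtain ⟨h₁, h₂⟩ := key w M.start hI
  rw [NFA.mem_accepts, NFA.mem_accepts, hstart, h₂]
  constructor
  · rintro ⟨_, h, s, hs, rfl⟩
    exact ⟨s, (hacc s (h₁ hs)).1 h, hs⟩
  · rintro ⟨s, h, hs⟩
    exact ⟨g s, (hacc s (h₁ hs)).2 h, s, hs, rfl⟩

/-- `Dependence.SplitStep` for sets given as lists of numbers, together with the independence of
the set that is read. -/
def SplitStepCode (d : List (ℕ × ℕ)) (c : NFACode ℕ) (p q : List ℕ × List ℕ × ℕ) : Prop :=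
  (∀ a ∈ q.1, ∀ b ∈ q.1, a = b ∨ (a, b) ∉ d) ∧ (∀ b ∈ q.1, ∃ a ∈ p.1, (a, b) ∈ d) ∧
    (∀ a ∈ p.2.1, a ∈ q.2.1) ∧ (∀ b ∈ q.1, b ∈ q.2.1 ∨ ∀ a ∈ p.2.1, (a, b) ∉ d) ∧
    q.2.2 ∈ c.evalList [p.2.2] (q.1.filter (· ∈ q.2.1))

/-- The list `l` enumerates the letters of `A` that do not belong to `S`. -/
def EnumeratesSDiff (l A S : List ℕ) : Prop :=
  (∀ a ∈ l, a ∈ A ∧ a ∉ S) ∧ ∀ a ∈ A, a ∈ S ∨ a ∈ l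

/-- A step of the automaton for the prefixes, where `A₁ \ S₁` and `A₂ \ S₂` are read. -/
def PrefixStepCode (c : NFACode (List ℕ × List ℕ)) (r : ℕ)
    (q : (List ℕ × List ℕ × ℕ) × (List ℕ × List ℕ × ℕ) × ℕ) : Prop :=
  ∃ t ∈ c.2.1, t.1 = r ∧ t.2.2 = q.2.2 ∧ EnumeratesSDiff t.2.1.1 q.1.1 q.1.2.1 ∧
    EnumeratesSDiff t.2.1.2 q.2.1.1 q.2.1.2.1

instance (d : List (ℕ × ℕ)) (c : NFACode ℕ) (p q : List ℕ × List ℕ × ℕ) :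
    Decidable (SplitStepCode d c p q) := by
  unfold SplitStepCode; infer_instance

instance (l A S : List ℕ) : Decidable (EnumeratesSDiff l A S) := by
  unfold EnumeratesSDiff; infer_instance

instance (c : NFACode (List ℕ × List ℕ)) (r : ℕ)
    (q : (List ℕ × List ℕ × ℕ) × (List ℕ × List ℕ × ℕ) × ℕ) : Decidable (PrefixStepCode c r q) := by
  unfold PrefixStepCode; infer_instance

/-- An instance of the problem: alphabet size, dependence relation, and the three automata. -/
abbrev MulProdInput : Type :=
  (ℕ × List (ℕ × ℕ)) × NFACode (List ℕ × List ℕ) × NFACode ℕ × NFACode ℕ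

/-- The states of one component of the automaton for the product. -/
def splitStates (n : ℕ) (c : NFACode ℕ) : List (List ℕ × List ℕ × ℕ) :=
  (subsetLists n).product ((subsetLists n).product c.states)

/-- The states of the automaton for the product. -/
def mulProdStates (x : MulProdInput) :
    List ((List ℕ × List ℕ × ℕ) × (List ℕ × List ℕ × ℕ) × ℕ) :=
  (splitStates x.1.1 x.2.2.1).product ((splitStates x.1.1 x.2.2.2).product x.2.1.states)

/-- The algorithm of the main theorem. -/
def mulProdCode (x : MulProdInput) : NFACode (List ℕ × List ℕ) :=
  (((mulProdStates x).filter fun p =>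
      (p.1.1 = List.range x.1.1 ∧ p.1.2.1 = [] ∧ p.1.2.2 ∈ x.2.2.1.1) ∧
      (p.2.1.1 = List.range x.1.1 ∧ p.2.1.2.1 = [] ∧ p.2.1.2.2 ∈ x.2.2.2.1) ∧
      p.2.2 ∈ x.2.1.1).map Encodable.encode,
    (((mulProdStates x).product (mulProdStates x)).filter fun t =>
      SplitStepCode x.1.2 x.2.2.1 t.1.1 t.2.1 ∧ SplitStepCode x.1.2 x.2.2.2 t.1.2.1 t.2.2.1 ∧
      PrefixStepCode x.2.1 t.1.2.2 t.2).map fun t =>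
        (Encodable.encode t.1, (t.2.1.1, t.2.2.1.1), Encodable.encode t.2),
    ((mulProdStates x).filter fun p =>
      p.1.2.2 ∈ x.2.2.1.2.2 ∧ p.2.1.2.2 ∈ x.2.2.2.2.2 ∧ p.2.2 ∈ x.2.1.2.2).map Encodable.encode)

/-! ### The algorithm is primitive recursive -/

section Primrec

attribute [local fun_prop] Primrec
attribute [local fun_prop] Primrec.id Primrec.const Primrec.comp Primrec.fst Primrec.snd
attribute [local fun_prop] Primrec.pair

variable {ι β γ : Type} [Primcodable ι] [Primcodable β] [Primcodable γ]

theorem primrec_map {f : ι → List β} {g : ι → β → γ} (hf : Primrec f)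
    (hg : Primrec fun x : ι × β => g x.1 x.2) : Primrec fun i => (f i).map (g i) :=
  Primrec.list_map hf hg

theorem primrec_filter {f : ι → List β} {p : ι → β → Prop} [∀ i, DecidablePred (p i)]
    (hf : Primrec f) (hp : PrimrecPred fun x : ι × β => p x.1 x.2) :
    Primrec fun i => (f i).filter (p i ·) :=
  (hp.primrecRel.swap.listFilter).comp hf Primrec.id

theorem primrecPred_forall_mem {f : ι → List β} {p : ι → β → Prop} (hf : Primrec f)
    (hp : PrimrecPred fun x : ι × β => p x.1 x.2) : PrimrecPred fun i => ∀ b ∈ f i, p i b :=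
  (hp.primrecRel.swap.forall_mem_list).comp hf Primrec.id

theorem primrecPred_exists_mem {f : ι → List β} {p : ι → β → Prop} (hf : Primrec f)
    (hp : PrimrecPred fun x : ι × β => p x.1 x.2) : PrimrecPred fun i => ∃ b ∈ f i, p i b :=
  (hp.primrecRel.swap.exists_mem_list).comp hf Primrec.id

theorem primrecPred_mem {f : ι → List β} {g : ι → β} (hf : Primrec f) (hg : Primrec g) :
    PrimrecPred fun i => g i ∈ f i :=
  (primrecPred_exists_mem (p := fun i b => b = g i) hf
    (Primrec.eq.comp (by fun_prop) (by fun_prop))).of_eq fun i => by simp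

theorem primrec_product {f : ι → List β} {g : ι → List γ} (hf : Primrec f) (hg : Primrec g) :
    Primrec fun i => (f i).product (g i) :=
  Primrec.list_flatMap hf
    (primrec_map (g := fun (x : ι × β) c => (x.2, c)) (by fun_prop) (by fun_prop))

theorem primrec_subsetLists : Primrec subsetLists := by
  refine Primrec.list_foldr (h := fun _ x => x.2 ++ x.2.map (x.1 :: ·)) Primrec.list_range
    (Primrec.const [[]]) ?_
  refine Primrec.list_append.comp (by fun_prop) ?_
  exact primrec_map (g := fun (x : ℕ × ℕ × List (List ℕ)) l => x.2.1 :: l) (by fun_prop)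
    (Primrec.list_cons.comp (by fun_prop) (by fun_prop))

theorem primrec_states {c : ι → NFACode β} (hc : Primrec c) : Primrec fun i => (c i).states :=
  Primrec.list_append.comp (by fun_prop)
    (primrec_map (g := fun _ (t : ℕ × β × ℕ) => t.2.2) (by fun_prop) (by fun_prop))

theorem primrec_evalList {c : ι → NFACode ℕ} {Q w : ι → List ℕ} (hc : Primrec c) (hQ : Primrec Q)
    (hw : Primrec w) : Primrec fun i => (c i).evalList (Q i) (w i) := by
  refine Primrec.list_foldl (h := fun i x => (c i).stepList x.1 x.2) hw hQ ?_
  refine primrec_map (g := fun _ (t : ℕ × ℕ × ℕ) => t.2.2)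
    (primrec_filter (p := fun (x : ι × List ℕ × ℕ) (t : ℕ × ℕ × ℕ) => t.1 ∈ x.2.1 ∧ t.2.1 = x.2.2)
      (by fun_prop) ?_) (by fun_prop)
  exact (primrecPred_mem (by fun_prop) (by fun_prop)).and
    (Primrec.eq.comp (by fun_prop) (by fun_prop))

theorem primrecPred_splitStepCode {d : ι → List (ℕ × ℕ)} {c : ι → NFACode ℕ}
    {p q : ι → List ℕ × List ℕ × ℕ} (hd : Primrec d) (hc : Primrec c) (hp : Primrec p)
    (hq : Primrec q) : PrimrecPred fun i => SplitStepCode (d i) (c i) (p i) (q i) := by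
  refine .and ?_ (.and ?_ (.and ?_ (.and ?_ ?_)))
  · refine primrecPred_forall_mem (by fun_prop) (primrecPred_forall_mem (by fun_prop) (.or ?_ ?_))
    · exact Primrec.eq.comp (by fun_prop) (by fun_prop)
    · exact (primrecPred_mem (by fun_prop) (by fun_prop)).not
  · exact primrecPred_forall_mem (by fun_prop) (primrecPred_exists_mem (by fun_prop)
      (primrecPred_mem (by fun_prop) (by fun_prop)))
  · exact primrecPred_forall_mem (by fun_prop) (primrecPred_mem (by fun_prop) (by fun_prop))
  · exact primrecPred_forall_mem (by fun_prop) ((primrecPred_mem (by fun_prop) (by fun_prop)).or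
      (primrecPred_forall_mem (by fun_prop) (primrecPred_mem (by fun_prop) (by fun_prop)).not))
  · refine primrecPred_mem (primrec_evalList hc ?_ (primrec_filter (by fun_prop) ?_))
      (by fun_prop)
    · exact Primrec.list_cons.comp (by fun_prop) (Primrec.const [])
    · exact primrecPred_mem (by fun_prop) (by fun_prop)

theorem primrecPred_enumeratesSDiff {l A S : ι → List ℕ} (hl : Primrec l) (hA : Primrec A)
    (hS : Primrec S) : PrimrecPred fun i => EnumeratesSDiff (l i) (A i) (S i) := by
  refine .and ?_ ?_
  · exact primrecPred_forall_mem (by fun_prop) ((primrecPred_mem (by fun_prop) (by fun_prop)).and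
      (primrecPred_mem (by fun_prop) (by fun_prop)).not)
  · exact primrecPred_forall_mem (by fun_prop) ((primrecPred_mem (by fun_prop) (by fun_prop)).or
      (primrecPred_mem (by fun_prop) (by fun_prop)))

theorem primrecPred_prefixStepCode {c : ι → NFACode (List ℕ × List ℕ)} {r : ι → ℕ}
    {q : ι → (List ℕ × List ℕ × ℕ) × (List ℕ × List ℕ × ℕ) × ℕ} (hc : Primrec c) (hr : Primrec r)
    (hq : Primrec q) : PrimrecPred fun i => PrefixStepCode (c i) (r i) (q i) := by
  refine primrecPred_exists_mem (by fun_prop) (.and ?_ (.and ?_ (.and ?_ ?_)))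
  · exact Primrec.eq.comp (by fun_prop) (by fun_prop)
  · exact Primrec.eq.comp (by fun_prop) (by fun_prop)
  · exact primrecPred_enumeratesSDiff (by fun_prop) (by fun_prop) (by fun_prop)
  · exact primrecPred_enumeratesSDiff (by fun_prop) (by fun_prop) (by fun_prop)

theorem primrec_splitStates {n : ι → ℕ} {c : ι → NFACode ℕ} (hn : Primrec n) (hc : Primrec c) :
    Primrec fun i => splitStates (n i) (c i) :=
  primrec_product (primrec_subsetLists.comp hn)
    (primrec_product (primrec_subsetLists.comp hn) (primrec_states hc))

theorem primrec_mulProdStates : Primrec mulProdStates :=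
  primrec_product (primrec_splitStates (by fun_prop) (by fun_prop))
    (primrec_product (primrec_splitStates (by fun_prop) (by fun_prop))
      (primrec_states (by fun_prop)))

theorem primrec_mulProdCode : Primrec mulProdCode := by
  refine .pair ?_ (.pair ?_ ?_)
  · refine primrec_map (primrec_filter primrec_mulProdStates ?_) (Primrec.encode.comp Primrec.snd)
    have hrange : Primrec fun y : MulProdInput ×
        ((List ℕ × List ℕ × ℕ) × (List ℕ × List ℕ × ℕ) × ℕ) => List.range y.1.1.1 :=
      Primrec.list_range.comp (by fun_prop)
    refine .and (.and ?_ (.and ?_ ?_)) (.and (.and ?_ (.and ?_ ?_)) ?_)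
    · exact Primrec.eq.comp (by fun_prop) hrange
    · exact Primrec.eq.comp (by fun_prop) (Primrec.const [])
    · exact primrecPred_mem (by fun_prop) (by fun_prop)
    · exact Primrec.eq.comp (by fun_prop) hrange
    · exact Primrec.eq.comp (by fun_prop) (Primrec.const [])
    · exact primrecPred_mem (by fun_prop) (by fun_prop)
    · exact primrecPred_mem (by fun_prop) (by fun_prop)
  · refine primrec_map (primrec_filter (primrec_product primrec_mulProdStates
      primrec_mulProdStates) ?_) ?_
    · refine .and ?_ (.and ?_ ?_)
      · exact primrecPred_splitStepCode (by fun_prop) (by fun_prop) (by fun_prop) (by fun_prop)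
      · exact primrecPred_splitStepCode (by fun_prop) (by fun_prop) (by fun_prop) (by fun_prop)
      · exact primrecPred_prefixStepCode (by fun_prop) (by fun_prop) (by fun_prop)
    · exact .pair (Primrec.encode.comp (by fun_prop))
        (.pair (by fun_prop) (Primrec.encode.comp (by fun_prop)))
  · refine primrec_map (primrec_filter primrec_mulProdStates ?_) (Primrec.encode.comp Primrec.snd)
    refine .and ?_ (.and ?_ ?_) <;> exact primrecPred_mem (by fun_prop) (by fun_prop)

end Primrec

/-! ### The algorithm is correct -/

open Dependence

/-- The elements of a set of letters in increasing order, as natural numbers. -/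
def letterList {n : ℕ} (A : Finset (Fin n)) : List ℕ := (enum (List.finRange n) A).map Fin.val

theorem mem_letterList {n : ℕ} {A : Finset (Fin n)} {x : ℕ} :
    x ∈ letterList A ↔ ∃ a ∈ A, (a : ℕ) = x := by
  simp [letterList, enum]

theorem val_mem_letterList {n : ℕ} {A : Finset (Fin n)} {a : Fin n} :
    (a : ℕ) ∈ letterList A ↔ a ∈ A := by
  simp [mem_letterList, Fin.val_inj]

theorem toFinset_letterList {n : ℕ} (A : Finset (Fin n)) :
    (letterList A).toFinset = A.map Fin.valEmbedding := by
  ext x; simp [mem_letterList]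

theorem letterList_injective {n : ℕ} : Function.Injective (letterList (n := n)) := fun A B h => by
  ext a; rw [← val_mem_letterList, h, val_mem_letterList]

theorem letterList_empty {n : ℕ} : letterList (∅ : Finset (Fin n)) = [] := by
  simp [letterList, enum]

theorem letterList_univ {n : ℕ} : letterList (List.finRange n).toFinset = List.range n := by
  simp [letterList, enum]

/-- Filtering keeps the increasing order, so the coded and the abstract automaton feed the same word
to the suffix automaton. -/
theorem filter_letterList {n : ℕ} (A S : Finset (Fin n)) :
    (letterList A).filter (· ∈ letterList S) = (enum (List.finRange n) (A ∩ S)).map Fin.val := by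
  rw [letterList.eq_def A, List.filter_map, enum, enum, List.filter_filter]
  congr 1
  exact List.filter_congr fun a _ => by simp [val_mem_letterList, Bool.and_comm]

/-- A sublist of a duplicate-free list is determined by its members; this makes sublists of `[0, …,
n - 1]` canonical codes of sets. -/
theorem eq_filter_of_sublist {β : Type*} [DecidableEq β] {l r : List β} (h : l.Sublist r)
    (hr : r.Nodup) : l = r.filter (· ∈ l) := by
  induction h with
  | slnil => rfl
  | @cons l r a h ih =>
    obtain ⟨ha, hr⟩ := List.nodup_cons.1 hr
    rw [List.filter_cons_of_neg (by simpa using fun h' => ha (h.subset h'))]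
    exact ih hr
  | @cons_cons l r a h ih =>
    obtain ⟨ha, hr⟩ := List.nodup_cons.1 hr
    rw [List.filter_cons_of_pos (by simp)]
    congr 1
    refine (ih hr).trans (List.filter_congr fun b hb => ?_)
    have : b ≠ a := fun e => ha (e ▸ hb)
    simp [this]

theorem mem_subsetLists_iff {n : ℕ} {l : List ℕ} :
    l ∈ subsetLists n ↔ ∃ A : Finset (Fin n), letterList A = l := by
  rw [mem_subsetLists]
  constructor
  · intro h
    refine ⟨Finset.univ.filter fun a => (a : ℕ) ∈ l, ?_⟩
    refine Eq.trans ?_ (eq_filter_of_sublist h List.nodup_range).symm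
    rw [← List.map_coe_finRange_eq_range, List.filter_map]
    simp [letterList, enum, Function.comp_def]
  · rintro ⟨A, rfl⟩
    rw [← List.map_coe_finRange_eq_range]
    exact List.filter_sublist.map _

/-- The state of the computed automaton that represents a state of `Dependence.mulProdNFA`. -/
def listState {n : ℕ} (p : Finset (Fin n) × Finset (Fin n) × ℕ) : List ℕ × List ℕ × ℕ :=
  (letterList p.1, letterList p.2.1, p.2.2)

theorem mem_splitStates {n : ℕ} {c : NFACode ℕ} {p : List ℕ × List ℕ × ℕ} :
    p ∈ splitStates n c ↔
      ∃ s : Finset (Fin n) × Finset (Fin n) × ℕ, listState s = p ∧ s.2.2 ∈ c.states := by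
  obtain ⟨a, b, k⟩ := p
  simp only [splitStates, List.pair_mem_product, mem_subsetLists_iff, listState, Prod.exists,
    Prod.mk.injEq]
  grind

/-- Independence of the set read appears separately because a state stores a plain set, while the
abstract automaton obtains it from the type of its letters. -/
theorem splitStepCode_listState {n : ℕ} {D : Dependence (Fin n)} {d : List (ℕ × ℕ)}
    (hd : DescribesDependence d D) (c : NFACode ℕ) (p q : Finset (Fin n) × Finset (Fin n) × ℕ) :
    SplitStepCode d c (listState p) (listState q) ↔
      (q.1 : Set (Fin n)).Pairwise D.Indep ∧
        D.SplitStep (List.finRange n) (c.toNFA DescribesLetter) p q := by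
  have hall : ∀ (A : Finset (Fin n)) (P : ℕ → Prop),
      (∀ x ∈ letterList A, P x) ↔ ∀ a ∈ A, P (a : ℕ) := by
    intro A P; simp only [mem_letterList]; grind
  have hex : ∀ (A : Finset (Fin n)) (P : ℕ → Prop),
      (∃ x ∈ letterList A, P x) ↔ ∃ a ∈ A, P (a : ℕ) := by
    intro A P; simp only [mem_letterList]; grind
  have hs : {x | x ∈ [p.2.2]} = {p.2.2} := by ext; simp
  have hM : (listState q).2.2 ∈ c.evalList [(listState p).2.2]
        ((listState q).1.filter (· ∈ (listState q).2.1)) ↔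
      q.2.2 ∈ (c.toNFA DescribesLetter).evalFrom {p.2.2} (enum (List.finRange n) (q.1 ∩ q.2.1)) := by
    change q.2.2 ∈ c.evalList [p.2.2] ((letterList q.1).filter (· ∈ letterList q.2.1)) ↔ _
    rw [filter_letterList, NFACode.mem_evalList, hs]
  unfold SplitStepCode SplitStep
  rw [hM]
  simp only [listState, hall, hex, val_mem_letterList, ← hd _ _]
  refine and_congr ?_ (and_congr Iff.rfl (and_congr Iff.rfl (and_congr ?_ Iff.rfl)))
  · simp only [Set.Pairwise, Indep, Finset.mem_coe, Fin.val_inj]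
    grind
  · grind

/-- Labels of the input automaton may list a set in any order and with repetitions, so they are
compared by membership only. -/
theorem enumeratesSDiff_letterList {n : ℕ} {l : List ℕ} {A S : Finset (Fin n)} :
    EnumeratesSDiff l (letterList A) (letterList S) ↔
      l.toFinset = (A \ S).map Fin.valEmbedding := by
  have h : EnumeratesSDiff l (letterList A) (letterList S) ↔
      ∀ x, x ∈ l ↔ x ∈ letterList A ∧ x ∉ letterList S := by
    unfold EnumeratesSDiff; grind
  rw [h, Finset.ext_iff]
  refine forall_congr' fun x => ?_
  simp only [List.mem_toFinset, Finset.mem_map, Finset.mem_sdiff, Fin.valEmbedding_apply]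
  refine iff_congr Iff.rfl ⟨?_, ?_⟩
  · rintro ⟨h₁, h₂⟩
    obtain ⟨a, ha, rfl⟩ := mem_letterList.1 h₁
    exact ⟨a, ⟨ha, fun h => h₂ (val_mem_letterList.2 h)⟩, rfl⟩
  · rintro ⟨a, ⟨h₁, h₂⟩, rfl⟩
    exact ⟨val_mem_letterList.2 h₁, fun h => h₂ (val_mem_letterList.1 h)⟩

/-- The state of the computed automaton that represents a state of `Dependence.mulProdNFA`. -/
def mulProdState {n : ℕ}
    (p : (Finset (Fin n) × Finset (Fin n) × ℕ) × (Finset (Fin n) × Finset (Fin n) × ℕ) × ℕ) :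
    (List ℕ × List ℕ × ℕ) × (List ℕ × List ℕ × ℕ) × ℕ :=
  (listState p.1, listState p.2.1, p.2.2)

theorem mem_mulProdStates {n : ℕ} {d : List (ℕ × ℕ)} {cR : NFACode (List ℕ × List ℕ)}
    {cK cL : NFACode ℕ} {p : (List ℕ × List ℕ × ℕ) × (List ℕ × List ℕ × ℕ) × ℕ} :
    p ∈ mulProdStates ((n, d), cR, cK, cL) ↔
      ∃ s : (Finset (Fin n) × Finset (Fin n) × ℕ) × (Finset (Fin n) × Finset (Fin n) × ℕ) × ℕ,
        mulProdState s = p ∧ s.1.2.2 ∈ cK.states ∧ s.2.1.2.2 ∈ cL.states ∧ s.2.2 ∈ cR.states := by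
  obtain ⟨a, b, k⟩ := p
  simp only [mulProdStates, List.pair_mem_product, mem_splitStates, mulProdState]
  constructor
  · rintro ⟨⟨s, rfl, hs⟩, ⟨t, rfl, ht⟩, hk⟩
    exact ⟨(s, t, k), rfl, hs, ht, hk⟩
  · rintro ⟨s, h, h₁, h₂, h₃⟩
    simp only [Prod.mk.injEq] at h
    obtain ⟨rfl, rfl, rfl⟩ := h
    exact ⟨⟨_, rfl, h₁⟩, ⟨_, rfl, h₂⟩, h₃⟩

theorem listState_injective {n : ℕ} : Function.Injective (listState (n := n)) := by
  rintro ⟨A, S, s⟩ ⟨B, T, t⟩ h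
  simp only [listState, Prod.mk.injEq] at h
  rw [letterList_injective h.1, letterList_injective h.2.1, h.2.2]

theorem mulProdState_injective {n : ℕ} : Function.Injective (mulProdState (n := n)) := by
  rintro ⟨A, S, s⟩ ⟨B, T, t⟩ h
  simp only [mulProdState, Prod.mk.injEq] at h
  rw [listState_injective h.1, listState_injective h.2.1, h.2.2]

/-! ### The computed automaton as an image of the abstract one -/

section

variable {n : ℕ} {D : Dependence (Fin n)} {d : List (ℕ × ℕ)} {cR : NFACode (List ℕ × List ℕ)}
  {cK cL : NFACode ℕ}

theorem encode_mem_filter {P : (List ℕ × List ℕ × ℕ) × (List ℕ × List ℕ × ℕ) × ℕ → Prop}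
    [DecidablePred P] {k : ℕ} :
    k ∈ ((mulProdStates ((n, d), cR, cK, cL)).filter fun p => P p).map Encodable.encode ↔
      ∃ s : (Finset (Fin n) × Finset (Fin n) × ℕ) × (Finset (Fin n) × Finset (Fin n) × ℕ) × ℕ,
        (s.1.2.2 ∈ cK.states ∧ s.2.1.2.2 ∈ cL.states ∧ s.2.2 ∈ cR.states) ∧ P (mulProdState s) ∧
          Encodable.encode (mulProdState s) = k := by
  simp only [List.mem_map, List.mem_filter, mem_mulProdStates, decide_eq_true_eq]
  constructor
  · rintro ⟨_, ⟨⟨s, rfl, h⟩, hP⟩, rfl⟩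
    exact ⟨s, h, hP, rfl⟩
  · rintro ⟨s, h, hP, rfl⟩
    exact ⟨_, ⟨⟨s, rfl, h⟩, hP⟩, rfl⟩

/-- The target state stores the pair of sets just read, so the label is recovered from it and the
letter `A` can be left existential. -/
theorem mem_transitions_mulProdCode (hd : DescribesDependence d D) {i j : ℕ}
    {b : List ℕ × List ℕ} :
    (i, b, j) ∈ (mulProdCode ((n, d), cR, cK, cL)).2.1 ↔
      ∃ s t : (Finset (Fin n) × Finset (Fin n) × ℕ) × (Finset (Fin n) × Finset (Fin n) × ℕ) × ℕ,
        ((s.1.2.2 ∈ cK.states ∧ s.2.1.2.2 ∈ cL.states ∧ s.2.2 ∈ cR.states) ∧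
          (t.1.2.2 ∈ cK.states ∧ t.2.1.2.2 ∈ cL.states ∧ t.2.2 ∈ cR.states)) ∧
        (∃ A : D.IndepSet × D.IndepSet, t ∈ (D.mulProdNFA (List.finRange n)
            (cR.toNFA (DescribesSets D)) (cK.toNFA DescribesLetter)
            (cL.toNFA DescribesLetter)).step s A) ∧
        i = Encodable.encode (mulProdState s) ∧ b = (letterList t.1.1, letterList t.2.1.1) ∧
        j = Encodable.encode (mulProdState t) := by
  have key : ∀ s t : (Finset (Fin n) × Finset (Fin n) × ℕ) ×
      (Finset (Fin n) × Finset (Fin n) × ℕ) × ℕ,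
      (SplitStepCode d cK (mulProdState s).1 (mulProdState t).1 ∧
        SplitStepCode d cL (mulProdState s).2.1 (mulProdState t).2.1 ∧
        PrefixStepCode cR (mulProdState s).2.2 (mulProdState t)) ↔
      ∃ A : D.IndepSet × D.IndepSet, t ∈ (D.mulProdNFA (List.finRange n)
            (cR.toNFA (DescribesSets D)) (cK.toNFA DescribesLetter)
            (cL.toNFA DescribesLetter)).step s A := by
    intro s t
    have hR : PrefixStepCode cR (mulProdState s).2.2 (mulProdState t) ↔
        ∃ b : List ℕ × List ℕ, (b.1.toFinset = (t.1.1 \ t.1.2.1).map Fin.valEmbedding ∧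
          b.2.toFinset = (t.2.1.1 \ t.2.1.2.1).map Fin.valEmbedding) ∧
          (s.2.2, b, t.2.2) ∈ cR.2.1 := by
      simp only [PrefixStepCode, mulProdState, listState, enumeratesSDiff_letterList]
      constructor
      · rintro ⟨⟨i, b, j⟩, h, rfl, rfl, h₁, h₂⟩
        exact ⟨b, ⟨h₁, h₂⟩, h⟩
      · rintro ⟨b, ⟨h₁, h₂⟩, h⟩
        exact ⟨_, h, rfl, rfl, h₁, h₂⟩
    rw [hR]
    simp only [mulProdState, splitStepCode_listState hd]
    constructor
    · rintro ⟨⟨hA, h₁⟩, ⟨hC, h₂⟩, b, hb, h₃⟩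
      exact ⟨(⟨t.1.1, hA⟩, ⟨t.2.1.1, hC⟩), rfl, rfl, h₁, h₂, b, hb, h₃⟩
    · rintro ⟨⟨⟨A, hA⟩, ⟨C, hC⟩⟩, hA', hC', h₁, h₂, b, hb, h₃⟩
      dsimp only at hA' hC'
      subst hA' hC'
      exact ⟨⟨hA, h₁⟩, ⟨hC, h₂⟩, b, hb, h₃⟩
  rw [mulProdCode, List.mem_map]
  constructor
  · rintro ⟨⟨p, q⟩, hpq, he⟩
    obtain ⟨hpq, hstep⟩ := List.mem_filter.1 hpq
    obtain ⟨hp, hq⟩ := List.pair_mem_product.1 hpq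
    obtain ⟨s, rfl, hs⟩ := mem_mulProdStates.1 hp
    obtain ⟨t, rfl, ht⟩ := mem_mulProdStates.1 hq
    simp only [Prod.mk.injEq] at he
    exact ⟨s, t, ⟨hs, ht⟩, (key s t).1 (of_decide_eq_true hstep), he.1.symm, he.2.1.symm,
      he.2.2.symm⟩
  · rintro ⟨s, t, ⟨hs, ht⟩, hstep, rfl, rfl, rfl⟩
    exact ⟨(mulProdState s, mulProdState t), List.mem_filter.2 ⟨List.pair_mem_product.2
      ⟨mem_mulProdStates.2 ⟨s, rfl, hs⟩, mem_mulProdStates.2 ⟨t, rfl, ht⟩⟩,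
      decide_eq_true ((key s t).2 hstep)⟩, rfl⟩

theorem describesSets_letterList {A C : Finset (Fin n)} {B : D.IndepSet × D.IndepSet} :
    DescribesSets D (letterList A, letterList C) B ↔ A = B.1.1 ∧ C = B.2.1 := by
  simp only [DescribesSets, toFinset_letterList, Finset.map_inj]

theorem accepts_mulProdCode (hd : DescribesDependence d D) :
    ((mulProdCode ((n, d), cR, cK, cL)).toNFA (DescribesSets D)).accepts =
      (D.mulProdNFA (List.finRange n) (cR.toNFA (DescribesSets D)) (cK.toNFA DescribesLetter)
        (cL.toNFA DescribesLetter)).accepts := by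
  have hinj : Function.Injective fun s => Encodable.encode (mulProdState (n := n) s) :=
    Encodable.encode_injective.comp mulProdState_injective
  have hstate : ∀ {β : Type} {c : NFACode β} {k : ℕ}, k ∈ c.1 → k ∈ c.states :=
    fun h => List.mem_append_left _ h
  have hstart : ∀ s : (Finset (Fin n) × Finset (Fin n) × ℕ) ×
      (Finset (Fin n) × Finset (Fin n) × ℕ) × ℕ,
      (((mulProdState s).1.1 = List.range n ∧ (mulProdState s).1.2.1 = [] ∧
          (mulProdState s).1.2.2 ∈ cK.1) ∧
        ((mulProdState s).2.1.1 = List.range n ∧ (mulProdState s).2.1.2.1 = [] ∧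
          (mulProdState s).2.1.2.2 ∈ cL.1) ∧ (mulProdState s).2.2 ∈ cR.1) ↔
      s ∈ (D.mulProdNFA (List.finRange n) (cR.toNFA (DescribesSets D))
        (cK.toNFA DescribesLetter) (cL.toNFA DescribesLetter)).start := by
    intro s
    -- Writing `List.range n` and `[]` as codes of sets turns equality of lists into equality of
    -- sets.
    simp only [mulProdState, listState, ← letterList_univ, ← letterList_empty (n := n),
      letterList_injective.eq_iff]
    rfl
  -- The invariant confines the three automaton states to the finite lists from which the code is
  -- built.
  refine accepts_eq_of_map _ _ (fun s => Encodable.encode (mulProdState s))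
    {s | s.1.2.2 ∈ cK.states ∧ s.2.1.2.2 ∈ cL.states ∧ s.2.2 ∈ cR.states} ?_ ?_ ?_ ?_ ?_
  · ext k
    refine encode_mem_filter.trans ?_
    simp only [hstart]
    constructor
    · rintro ⟨s, -, h, rfl⟩
      exact ⟨s, h, rfl⟩
    · rintro ⟨s, h, rfl⟩
      exact ⟨s, ⟨hstate h.1.2.2, hstate h.2.1.2.2, hstate h.2.2⟩, h, rfl⟩
  · rintro s h
    exact ⟨hstate h.1.2.2, hstate h.2.1.2.2, hstate h.2.2⟩
  · rintro s ⟨hs₁, hs₂, -⟩ A t ⟨-, -, h₁, h₂, h₃⟩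
    exact ⟨NFACode.mem_states_of_evalFrom _ (by rintro _ rfl; exact hs₁) h₁.2.2.2,
      NFACode.mem_states_of_evalFrom _ (by rintro _ rfl; exact hs₂) h₂.2.2.2,
      NFACode.mem_states_of_step h₃⟩
  · rintro s hs A
    ext k
    constructor
    · rintro ⟨b, hb, h⟩
      obtain ⟨s', t, -, ⟨B, ht⟩, he, rfl, rfl⟩ := (mem_transitions_mulProdCode hd).1 h
      -- Equal codes come from equal states, so the transition really starts in `s`; its label then
      -- forces `B = A`.
      obtain rfl := hinj he
      obtain ⟨hA₁, hA₂⟩ := describesSets_letterList.1 hb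
      obtain rfl : B = A := Prod.ext (Subtype.ext (ht.1.symm.trans hA₁))
        (Subtype.ext (ht.2.1.symm.trans hA₂))
      exact ⟨t, ht, rfl⟩
    · rintro ⟨t, ht, rfl⟩
      refine ⟨(letterList t.1.1, letterList t.2.1.1),
        describesSets_letterList.2 ⟨ht.1, ht.2.1⟩, (mem_transitions_mulProdCode hd).2
          ⟨s, t, ⟨hs, ?_⟩, ⟨A, ht⟩, rfl, rfl, rfl⟩⟩
      obtain ⟨-, -, h₁, h₂, h₃⟩ := ht
      exact ⟨NFACode.mem_states_of_evalFrom _ (by rintro _ rfl; exact hs.1) h₁.2.2.2,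
        NFACode.mem_states_of_evalFrom _ (by rintro _ rfl; exact hs.2.1) h₂.2.2.2,
        NFACode.mem_states_of_step h₃⟩
  · rintro s hs
    refine encode_mem_filter.trans ⟨?_, fun h => ⟨s, hs, h, rfl⟩⟩
    rintro ⟨s', -, h, he⟩
    obtain rfl := hinj he
    exact h

theorem presents_mulProdCode (hd : DescribesDependence d D) {R : Set (D.Trace × D.Trace)}
    {K L : Set D.Trace} (hR : cR.Presents (DescribesSets D) (D.foataLanguage R))
    (hK : cK.Presents DescribesLetter (D.wordLanguage K))
    (hL : cL.Presents DescribesLetter (D.wordLanguage L)) :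
    (mulProdCode ((n, d), cR, cK, cL)).Presents (DescribesSets D)
      (D.foataLanguage (D.mulProd R K L)) := by
  refine ⟨?_, ?_⟩
  · rintro ⟨i, b, j⟩ h
    obtain ⟨s, t, -, ⟨A, ht⟩, rfl, rfl, rfl⟩ := (mem_transitions_mulProdCode hd).1 h
    exact ⟨A, describesSets_letterList.2 ⟨ht.1, ht.2.1⟩⟩
  · rw [accepts_mulProdCode hd]
    exact D.accepts_mulProdNFA (List.nodup_finRange n) List.mem_finRange hR.2 hK.2 hL.2

end

end FoataTrace

/-- If `R` is fnf-automatic and `K`, `L` are recognizable, then `R · (K × L)` is fnf-automatic, and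
there is one algorithm that, given an alphabet size, a dependence relation, and NFAs for `L_R` and
for the word languages of `K` and `L`, computes an NFA for `L_{R · (K × L)}`. -/
theorem mainTheorem6 :
    (∀ (α : Type*) [Finite α] (D : Dependence α) (R : Set (D.Trace × D.Trace))
        (K L : Set D.Trace),
      D.IsFnfAutomatic R → D.IsRecognizable K → D.IsRecognizable L →
        D.IsFnfAutomatic (D.mulProd R K L)) ∧
    ∃ f : (ℕ × List (ℕ × ℕ)) × NFACode (List ℕ × List ℕ) × NFACode ℕ × NFACode ℕ →
        NFACode (List ℕ × List ℕ),
      Computable f ∧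
      ∀ (n : ℕ) (D : Dependence (Fin n)) (d : List (ℕ × ℕ)), DescribesDependence d D →
        ∀ (R : Set (D.Trace × D.Trace)) (K L : Set D.Trace)
          (cR : NFACode (List ℕ × List ℕ)) (cK cL : NFACode ℕ),
          cR.Presents (DescribesSets D) (D.foataLanguage R) →
          cK.Presents DescribesLetter (D.wordLanguage K) →
          cL.Presents DescribesLetter (D.wordLanguage L) →
          (f ((n, d), cR, cK, cL)).Presents (DescribesSets D)
            (D.foataLanguage (D.mulProd R K L)) := by
  refine ⟨fun α _ D R K L => D.isFnfAutomatic_mulProd, mulProdCode,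
    primrec_mulProdCode.to_comp, ?_⟩
  intro n D d hd R K L cR cK cL hR hK hL
  exact presents_mulProdCode hd hR hK hL
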